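/- \textbf{Theorem.} MCCS terms are generated by $P,Q ::= 1 \mid P\mid Q \mid a.P \mid \bar a.P$, with $a$ ranging over a set of channel names. \emph{Structural congruence} $\equiv$ is the smallest congruence making parallel composition commutative and associative with neutral element $1$; \emph{top-level structural congruence} $\equiv_{\mathrm{top}}$ is the smallest equivalence relation compatible with parallel composition (but not required to be compatible with prefixes) with the same properties. For $r$ one of these two relations, $\to_r^*$ denotes the reflexive transitive closure, over classes modulo $r$, of the execution rule $\bar a.P\mid a.Q\mid R\to P\mid Q\mid R$ (so that $P\to_r^*Q$ holds with no step exactly when $P\mathrel{r}Q$). Formulas are generated from variables $\alpha,\alpha^\perp$ (from an infinite set) by $\otimes$, $⅋$ and modalities $\langle a\rangle A$, $\langle\bar a\rangle A$, with De Morgan negation, $(\langle a\rangle A)^\perp=\langle\bar a\rangle A^\perp$, and $A\multimap B:=A^\perp⅋B$. The synchronous type $\lfloor P\rfloor_s$ is defined, up to the choice of the variables, by $$\lfloor 1\rfloor_s=\alpha^\perp⅋\alpha,\quad \lfloor P\mid Q\rfloor_s=\lfloor P\rfloor_s\otimes\lfloor Q\rfloor_s,\quad \lfloor a.P\rfloor_s=\langle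 a\rangle(\alpha^\perp⅋(\lfloor P\rfloor_s\otimes\alpha)),\quad \lfloor\bar a.P\rfloor_s=\langle\bar a\rangle(\lfloor P\rfloor_s\otimes\alpha^\perp)⅋\alpha,$$ where $\alpha$ is a fresh variable in each case (and the types of the two components of a parallel composition share no variable). \emph{Provable in MLL} means derivable by the rules axiom ($\vdash A^\perp,A$ for any formula $A$), cut, $\otimes$, $⅋$ and exchange, without any rule for the modalities. Let $P$ and $Q$ be MCCS terms. Then: \begin{enumerate} \item $P\to_{\equiv_{\mathrm{top}}}^*Q$ if and only if there is an instantiation $\sigma$ of the propositional variables of $\lfloor P\rfloor_s$ by formulas such that $\lfloor P\rfloor_s\sigma\multimap\lfloor Q\rfloor_s$ is provable in MLL. \item $P\to_{\equiv}^*Q$ if and only if there are a term $Q'\equiv Q$ and an instantiation $\sigma$ of the propositional variables of $\lfloor P\rfloor_s$ by formulas such that $\lfloor P\rfloor_s\sigma\multimap\lfloor Q'\rfloor_s$ is provable in MLL. \end{enumerate} -/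

import Mathlib

/-- Terms of multiplicative CCS over the channel names `C` (locations, which are only
bookkeeping and do not affect execution or types, are left implicit). -/
inductive MCCS (C : Type*) where
  /-- the inactive process `1` -/
  | one : MCCS C
  /-- parallel composition `P | Q` -/
  | par (P Q : MCCS C) : MCCS C
  /-- positive action prefix `a.P` -/
  | pos (a : C) (P : MCCS C) : MCCS C
  /-- negative action prefix `ā.P` -/
  | neg (a : C) (P : MCCS C) : MCCS C

namespace MCCS

/-- Structural congruence: the smallest congruence (for all constructors, prefixes included) that
makes parallel composition commutative and associative with neutral element `1`. -/
inductive Cong {C : Type*} : MCCS C → MCCS C → Prop where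
  | refl (P : MCCS C) : Cong P P
  | symm {P Q : MCCS C} : Cong P Q → Cong Q P
  | trans {P Q R : MCCS C} : Cong P Q → Cong Q R → Cong P R
  | par_comm (P Q : MCCS C) : Cong (par P Q) (par Q P)
  | par_assoc (P Q R : MCCS C) : Cong (par (par P Q) R) (par P (par Q R))
  | par_one (P : MCCS C) : Cong (par P one) P
  | par {P P' Q Q' : MCCS C} : Cong P P' → Cong Q Q' → Cong (par P Q) (par P' Q')
  | pos (a : C) {P P' : MCCS C} : Cong P P' → Cong (pos a P) (pos a P')
  | neg (a : C) {P P' : MCCS C} : Cong P P' → Cong (neg a P) (neg a P')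

/-- Structural congruence at top level, that is, not under prefixes: the smallest equivalence
compatible with parallel composition that makes it commutative and associative with neutral
element `1`. -/
inductive TopCong {C : Type*} : MCCS C → MCCS C → Prop where
  | refl (P : MCCS C) : TopCong P P
  | symm {P Q : MCCS C} : TopCong P Q → TopCong Q P
  | trans {P Q R : MCCS C} : TopCong P Q → TopCong Q R → TopCong P R
  | par_comm (P Q : MCCS C) : TopCong (par P Q) (par Q P)
  | par_assoc (P Q R : MCCS C) : TopCong (par (par P Q) R) (par P (par Q R))
  | par_one (P : MCCS C) : TopCong (par P one) P
  | par {P P' Q Q' : MCCS C} : TopCong P P' → TopCong Q Q' → TopCong (par P Q) (par P' Q')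

/-- One execution step `ā.P | a.Q | R → P | Q | R`, up to the congruence `r` on both sides. -/
def Step {C : Type*} (r : MCCS C → MCCS C → Prop) (S T : MCCS C) : Prop :=
  ∃ (a : C) (P Q R : MCCS C),
    r S (par (par (neg a P) (pos a Q)) R) ∧ r (par (par P Q) R) T

/-- Executions `P →* Q`: the reflexive transitive closure of the execution step on classes modulo
the congruence `r`; an execution without steps is an instance of `r`. -/
def Exec {C : Type*} (r : MCCS C → MCCS C → Prop) : MCCS C → MCCS C → Prop :=
  Relation.ReflTransGen (fun S T => r S T ∨ Step r S T)

end MCCS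

/-- Formulas of multiplicative linear logic with actions, over the propositional variables `V` and
the channel names `C`. -/
inductive MLLa (C V : Type*) where
  /-- `α` -/
  | var (α : V) : MLLa C V
  /-- `α^⊥` -/
  | nvar (α : V) : MLLa C V
  /-- `A ⊗ B` -/
  | tensor (A B : MLLa C V) : MLLa C V
  /-- `A ⅋ B` -/
  | parr (A B : MLLa C V) : MLLa C V
  /-- `⟨a⟩ A` -/
  | modPos (a : C) (A : MLLa C V) : MLLa C V
  /-- `⟨ā⟩ A` -/
  | modNeg (a : C) (A : MLLa C V) : MLLa C V

namespace MLLa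

/-- Linear negation `A^⊥`. -/
def dual {C V : Type*} : MLLa C V → MLLa C V
  | var α => nvar α
  | nvar α => var α
  | tensor A B => parr A.dual B.dual
  | parr A B => tensor A.dual B.dual
  | modPos a A => modNeg a A.dual
  | modNeg a A => modPos a A.dual

/-- Linear implication `A ⊸ B`. -/
def limp {C V : Type*} (A B : MLLa C V) : MLLa C V := parr A.dual B

/-- The set of propositional variables that occur in a formula. -/
def vars {C V : Type*} : MLLa C V → Set V
  | var α => {α}
  | nvar α => {α}
  | tensor A B => A.vars ∪ B.vars
  | parr A B => A.vars ∪ B.vars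
  | modPos _ A => A.vars
  | modNeg _ A => A.vars

/-- Instantiation of the propositional variables of a formula by formulas. -/
def inst {C V : Type*} (σ : V → MLLa C V) : MLLa C V → MLLa C V
  | var α => σ α
  | nvar α => (σ α).dual
  | tensor A B => tensor (A.inst σ) (B.inst σ)
  | parr A B => parr (A.inst σ) (B.inst σ)
  | modPos a A => modPos a (A.inst σ)
  | modNeg a A => modNeg a (A.inst σ)

/-- Provability of sequents in pure MLL: axiom (on arbitrary formulas), cut, `⊗`, `⅋` and exchange,
and no rule that introduces a modality. -/
inductive MLLProvable {C V : Type*} : List (MLLa C V) → Prop where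
  | ax (A : MLLa C V) : MLLProvable [A.dual, A]
  | cut {A : MLLa C V} {Γ Δ : List (MLLa C V)} :
      MLLProvable (A :: Γ) → MLLProvable (A.dual :: Δ) → MLLProvable (Γ ++ Δ)
  | tensor {A B : MLLa C V} {Γ Δ : List (MLLa C V)} :
      MLLProvable (A :: Γ) → MLLProvable (B :: Δ) → MLLProvable (tensor A B :: (Γ ++ Δ))
  | parr {A B : MLLa C V} {Γ : List (MLLa C V)} :
      MLLProvable (A :: B :: Γ) → MLLProvable (parr A B :: Γ)
  | exch {Γ Δ : List (MLLa C V)} : Γ.Perm Δ → MLLProvable Γ → MLLProvable Δ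

end MLLa

/-- `SyncType P A`: the formula `A` is the synchronous type of the term `P`, for some choice of the
fresh propositional variables (the type is determined up to renaming of its variables). -/
inductive SyncType {C V : Type*} : MCCS C → MLLa C V → Prop where
  | one (α : V) : SyncType .one (.parr (.nvar α) (.var α))
  | par {P Q : MCCS C} {A B : MLLa C V} : SyncType P A → SyncType Q B →
      Disjoint A.vars B.vars → SyncType (.par P Q) (.tensor A B)
  | pos (a : C) {P : MCCS C} {A : MLLa C V} (α : V) : SyncType P A → α ∉ A.vars →
      SyncType (.pos a P) (.modPos a (.parr (.nvar α) (.tensor A (.var α))))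
  | neg (a : C) {P : MCCS C} {A : MLLa C V} (α : V) : SyncType P A → α ∉ A.vars →
      SyncType (.neg a P) (.parr (.modNeg a (.tensor A (.nvar α))) (.var α))

theorem MLLa.vars_finite {C V : Type*} (A : MLLa C V) : A.vars.Finite := by
  induction A with
  | var α => exact Set.finite_singleton α
  | nvar α => exact Set.finite_singleton α
  | tensor A B hA hB => exact hA.union hB
  | parr A B hA hB => exact hA.union hB
  | modPos a A h => exact h
  | modNeg a A h => exact h

theorem exists_syncType_disjoint {C V : Type*} [Infinite V] (P : MCCS C) :
    ∀ S : Set V, S.Finite → ∃ A : MLLa C V, SyncType P A ∧ Disjoint A.vars S := by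
  induction P with
  | one =>
    intro S hS
    obtain ⟨α, hα⟩ := hS.exists_notMem
    exact ⟨_, .one α, by simpa [MLLa.vars] using hα⟩
  | par P Q hP hQ =>
    intro S hS
    obtain ⟨A, hA, dA⟩ := hP S hS
    obtain ⟨B, hB, dB⟩ := hQ (A.vars ∪ S) (A.vars_finite.union hS)
    rw [Set.disjoint_union_right] at dB
    exact ⟨_, .par hA hB dB.1.symm, by
      rw [MLLa.vars, Set.disjoint_union_left]; exact ⟨dA, dB.2⟩⟩
  | pos a P hP =>
    intro S hS
    obtain ⟨A, hA, dA⟩ := hP S hS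
    obtain ⟨α, hα⟩ := (A.vars_finite.union hS).exists_notMem
    rw [Set.mem_union, not_or] at hα
    exact ⟨_, .pos a α hA hα.1, by simp [MLLa.vars, hα.2, dA]⟩
  | neg a P hP =>
    intro S hS
    obtain ⟨A, hA, dA⟩ := hP S hS
    obtain ⟨α, hα⟩ := (A.vars_finite.union hS).exists_notMem
    rw [Set.mem_union, not_or] at hα
    exact ⟨_, .neg a α hA hα.1, by simp [MLLa.vars, hα.2, dA]⟩

/-- With infinitely many propositional variables, every term has a synchronous type. -/
theorem exists_syncType {C V : Type*} [Infinite V] (P : MCCS C) :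
    ∃ A : MLLa C V, SyncType P A :=
  (exists_syncType_disjoint P ∅ Set.finite_empty).imp fun _ h => h.1

/-!
Instances of the type of a term `P` are described without variables by `IsTypeInst P F`; the
freshness conditions on types mean exactly that `F` is an instance of a type of `P` if and only if
`IsTypeInst P F` (`SyncType.isTypeInst_inst`, `SyncType.exists_inst_eq`).

From executions to proofs, it is shown that for each instance `G` of the type of `Q` some instance
`F` of the type of `P` proves it (`Entails`). For a synchronisation `ā.P | a.Q → P | Q`, the formula
`α` of `a.Q` is taken to be the type of `P`, and that of `ā.P` the tensor product of the types of
`Q` and `P`, so that the step is a modus ponens.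

From proofs to executions, MLL is interpreted in a phase space. Its monoid consists of the pairs
`(S, T)` of multisets of guarded terms, and its pole of the pairs such that `S →* T`. The point is
the interpretation of the modalities, which depends on the formula underneath: `⟨a⟩(L ⅋ B)` is
the set of those `(S, T)` that yield an element of `⟦B⟧` when put next to `ā.P`, for `P` of type
`L^⊥`, and that satisfy `S →* T | a.Q` whenever the formula has the shape of a type of `a.Q`. Then
`(P, 0)`, for `P` read as the multiset of its guarded components, belongs to the interpretation of
all instances of its type (`IsTypeInst.mem_interp`), whatever the values of the variables.
Conversely, if the variable `α` of each top-level component `ā.P'` of `Q` is given the value `ā.P'`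
and other variables the value `0`, then `(S, T) ∈ ⟦⌊Q⌋⟧` implies `S →* T | Q`
(`SyncType.exists_valuation`). Soundness of the phase space (`Phase.sound`) gives `P →* Q`.

For the full structural congruence, rearrangements under prefixes can be postponed to the
end of an execution (`MCCS.Exec.exists_topCong_exec`), because congruent terms have pairwise
congruent guarded components (`MCCS.Cong.rel_comps`).
-/

/-! ### Guarded components of a term -/

namespace MCCS

/-- The guarded terms: `pos a P` stands for `a.P` and `neg a P` for `ā.P`. -/
inductive Guard (C : Type*) where
  | pos (a : C) (P : MCCS C) : Guard C
  | neg (a : C) (P : MCCS C) : Guard C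

/-- A guarded term as a term. -/
def Guard.toTerm {C : Type*} : Guard C → MCCS C
  | .pos a P => MCCS.pos a P
  | .neg a P => MCCS.neg a P

/-- The multiset of guarded components of a term. -/
def comps {C : Type*} : MCCS C → Multiset (Guard C)
  | one => 0
  | par P Q => P.comps + Q.comps
  | pos a P => {.pos a P}
  | neg a P => {.neg a P}

/-- The parallel composition of a list of guarded terms. -/
def ofList {C : Type*} : List (Guard C) → MCCS C
  | [] => one
  | g :: l => par g.toTerm (ofList l)

/-- A term whose guarded components are those of the given multiset, in an arbitrary order. -/
noncomputable def ofComps {C : Type*} (S : Multiset (Guard C)) : MCCS C := ofList S.toList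

variable {C : Type*}

theorem Guard.comps_toTerm (g : Guard C) : g.toTerm.comps = {g} := by
  cases g <;> rfl

theorem comps_ofList (l : List (Guard C)) : (ofList l).comps = (l : Multiset (Guard C)) := by
  induction l with
  | nil => rfl
  | cons g l ih => simp [ofList, comps, ih, Guard.comps_toTerm]

theorem comps_ofComps (S : Multiset (Guard C)) : (ofComps S).comps = S := by
  simp [ofComps, comps_ofList]

theorem TopCong.comps_eq {P Q : MCCS C} (h : TopCong P Q) : P.comps = Q.comps := by
  induction h with
  | refl => rfl
  | symm _ ih => exact ih.symm
  | trans _ _ ih ih' => exact ih.trans ih'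
  | par_comm P Q => exact add_comm _ _
  | par_assoc P Q R => exact add_assoc _ _ _
  | par_one P => exact add_zero _
  | par _ _ ih ih' => simp only [comps, ih, ih']

theorem TopCong.one_par (P : MCCS C) : TopCong (MCCS.par one P) P :=
  (TopCong.par_comm _ _).trans (.par_one P)

theorem TopCong.par_left_comm (P Q R : MCCS C) :
    TopCong (MCCS.par P (MCCS.par Q R)) (MCCS.par Q (MCCS.par P R)) :=
  (TopCong.par_assoc P Q R).symm.trans
    (((TopCong.par_comm P Q).par (.refl R)).trans (.par_assoc Q P R))

theorem TopCong.ofList_append (l l' : List (Guard C)) :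
    TopCong (ofList (l ++ l')) (MCCS.par (ofList l) (ofList l')) := by
  induction l with
  | nil => exact (TopCong.one_par _).symm
  | cons g l ih => exact ((TopCong.refl _).par ih).trans (TopCong.par_assoc _ _ _).symm

theorem TopCong.ofList_perm {l l' : List (Guard C)} (h : l.Perm l') :
    TopCong (ofList l) (ofList l') := by
  induction h with
  | nil => exact .refl _
  | cons g _ ih => exact (TopCong.refl _).par ih
  | swap g g' l => exact TopCong.par_left_comm _ _ _
  | trans _ _ ih ih' => exact ih.trans ih'

theorem TopCong.exists_ofList (P : MCCS C) : ∃ l, TopCong P (ofList l) := by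
  induction P with
  | one => exact ⟨[], .refl _⟩
  | par P Q hP hQ =>
    obtain ⟨l, hl⟩ := hP
    obtain ⟨l', hl'⟩ := hQ
    exact ⟨l ++ l', (hl.par hl').trans (TopCong.ofList_append l l').symm⟩
  | pos a P => exact ⟨[.pos a P], (TopCong.par_one _).symm⟩
  | neg a P => exact ⟨[.neg a P], (TopCong.par_one _).symm⟩

theorem TopCong.of_comps_eq {P Q : MCCS C} (h : P.comps = Q.comps) : TopCong P Q := by
  obtain ⟨l, hl⟩ := TopCong.exists_ofList P
  obtain ⟨l', hl'⟩ := TopCong.exists_ofList Q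
  rw [hl.comps_eq, hl'.comps_eq, comps_ofList, comps_ofList, Multiset.coe_eq_coe] at h
  exact hl.trans ((TopCong.ofList_perm h).trans hl'.symm)

/-! ### Execution on multisets of guarded terms -/

/-- One execution step on multisets of guarded terms. -/
inductive Red : Multiset (Guard C) → Multiset (Guard C) → Prop where
  | comm (a : C) (P Q : MCCS C) (R : Multiset (Guard C)) :
      Red ({.neg a P} + {.pos a Q} + R) (P.comps + Q.comps + R)

/-- Execution on multisets of guarded terms. -/
def Reds : Multiset (Guard C) → Multiset (Guard C) → Prop := Relation.ReflTransGen Red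

theorem Reds.refl (S : Multiset (Guard C)) : Reds S S := Relation.ReflTransGen.refl

theorem Reds.add_right {S T : Multiset (Guard C)} (h : Reds S T) (R : Multiset (Guard C)) :
    Reds (S + R) (T + R) := by
  refine Relation.ReflTransGen.lift (p := Red) (· + R) ?_ S T h
  rintro _ _ ⟨a, P, Q, R'⟩
  simpa only [Function.onFun, add_assoc] using Red.comm a P Q (R' + R)

theorem Reds.add {S T S' T' : Multiset (Guard C)} (h : Reds S T) (h' : Reds S' T') :
    Reds (S + S') (T + T') := by
  refine (h.add_right S').trans ?_
  rw [add_comm T S', add_comm T T']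
  exact h'.add_right T

theorem Reds.exec {P Q : MCCS C} (h : Reds P.comps Q.comps) : Exec TopCong P Q := by
  suffices ∀ S, Reds P.comps S → Exec TopCong P (ofComps S) from
    (this _ h).tail (.inl (TopCong.of_comps_eq (comps_ofComps _)))
  intro S hS
  induction hS with
  | refl => exact .single (.inl (TopCong.of_comps_eq (comps_ofComps _).symm))
  | tail _ hs ih =>
    refine ih.tail (.inr ?_)
    obtain ⟨a, P, Q, R⟩ := hs
    exact ⟨a, P, Q, ofComps R, TopCong.of_comps_eq (by simp only [comps, comps_ofComps]),
      TopCong.of_comps_eq (by simp only [comps, comps_ofComps])⟩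

/-! ### Postponing structural congruence under prefixes -/

theorem TopCong.cong {P Q : MCCS C} (h : TopCong P Q) : Cong P Q := by
  induction h with
  | refl => exact .refl _
  | symm _ ih => exact .symm ih
  | trans _ _ ih ih' => exact .trans ih ih'
  | par_comm P Q => exact .par_comm _ _
  | par_assoc P Q R => exact .par_assoc _ _ _
  | par_one P => exact .par_one _
  | par _ _ ih ih' => exact .par ih ih'

/-- Guarded terms with the same prefix and structurally congruent continuations. -/
inductive Guard.Cong : Guard C → Guard C → Prop where
  | pos (a : C) {P Q : MCCS C} : MCCS.Cong P Q → Guard.Cong (.pos a P) (.pos a Q)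
  | neg (a : C) {P Q : MCCS C} : MCCS.Cong P Q → Guard.Cong (.neg a P) (.neg a Q)

theorem Guard.Cong.refl (g : Guard C) : Guard.Cong g g := by
  cases g with
  | pos a P => exact .pos a (.refl P)
  | neg a P => exact .neg a (.refl P)

theorem Guard.Cong.symm {g h : Guard C} (H : Guard.Cong g h) : Guard.Cong h g := by
  cases H with
  | pos a H => exact .pos a H.symm
  | neg a H => exact .neg a H.symm

theorem Guard.Cong.trans {g h k : Guard C} (H : Guard.Cong g h) (H' : Guard.Cong h k) :
    Guard.Cong g k := by
  cases H with
  | pos a H => cases H' with | pos _ H' => exact .pos a (H.trans H')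
  | neg a H => cases H' with | neg _ H' => exact .neg a (H.trans H')

instance : IsTrans (Guard C) Guard.Cong := ⟨fun _ _ _ => Guard.Cong.trans⟩

theorem Cong.rel_comps {P Q : MCCS C} (h : Cong P Q) :
    Multiset.Rel Guard.Cong P.comps Q.comps := by
  have hrefl (S : Multiset (Guard C)) : Multiset.Rel Guard.Cong S S :=
    Multiset.rel_refl_of_refl_on fun g _ => Guard.Cong.refl g
  induction h with
  | refl => exact hrefl _
  | symm _ ih =>
    rw [← Multiset.rel_flip]
    exact ih.mono fun _ _ _ _ => Guard.Cong.symm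
  | trans _ _ ih ih' => exact ih.trans _ ih'
  | par_comm P Q => rw [comps, comps, add_comm]; exact hrefl _
  | par_assoc P Q R => simp only [comps, add_assoc]; exact hrefl _
  | par_one P => simp only [comps, add_zero]; exact hrefl _
  | par _ _ ih ih' => exact ih.add ih'
  | pos a h _ => exact .cons (.pos a h) .zero
  | neg a h _ => exact .cons (.neg a h) .zero

theorem Cong.of_rel_comps {P Q : MCCS C} (h : Multiset.Rel Guard.Cong P.comps Q.comps) :
    Cong P Q := by
  suffices ∀ S T : Multiset (Guard C), Multiset.Rel Guard.Cong S T →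
      ∀ P Q, P.comps = S → Q.comps = T → Cong P Q from this _ _ h _ _ rfl rfl
  intro S T h
  induction h with
  | zero => exact fun P Q hP hQ => (TopCong.of_comps_eq (hP.trans hQ.symm)).cong
  | @cons g g' S T hg _ ih =>
    intro P Q hP hQ
    have hP' : TopCong P (MCCS.par g.toTerm (ofComps S)) :=
      TopCong.of_comps_eq (by simp [hP, comps, comps_ofComps, Guard.comps_toTerm])
    have hQ' : TopCong (MCCS.par g'.toTerm (ofComps T)) Q :=
      TopCong.of_comps_eq (by simp [hQ, comps, comps_ofComps, Guard.comps_toTerm])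
    refine hP'.cong.trans (.trans (.par ?_ (ih _ _ (comps_ofComps S) (comps_ofComps T))) hQ'.cong)
    cases hg with
    | pos a H => exact .pos a H
    | neg a H => exact .neg a H

theorem Exec.of_topCong {P Q : MCCS C} (h : Exec TopCong P Q) : Exec Cong P Q := by
  refine Relation.ReflTransGen.mono ?_ P Q h
  rintro S T (h | ⟨a, P, Q, R, h, h'⟩)
  · exact .inl h.cong
  · exact .inr ⟨a, P, Q, R, h.cong, h'.cong⟩

/-- Congruence under prefixes can be postponed to the end of an execution. -/
theorem Exec.exists_topCong_exec {P Q : MCCS C} (h : Exec Cong P Q) :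
    ∃ Q', Cong Q' Q ∧ Exec TopCong P Q' := by
  induction h with
  | refl => exact ⟨P, .refl P, .refl⟩
  | @tail S T _ hs ih =>
    obtain ⟨S', hS, hP⟩ := ih
    obtain h | ⟨a, P₁, P₂, R, h, h'⟩ := hs
    · exact ⟨S', hS.trans h, hP⟩
    · -- the components of `S'` matching the two synchronising prefixes also synchronise
      have hrel := (hS.trans h).rel_comps
      simp only [comps, Multiset.singleton_add, Multiset.cons_add] at hrel
      obtain ⟨g₁, S₁, h₁, hrel, e₁⟩ := Multiset.rel_cons_right.1 hrel
      obtain ⟨g₂, S₂, h₂, hrel, e₂⟩ := Multiset.rel_cons_right.1 hrel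
      cases h₁ with
      | @neg _ P₁' _ h₁ =>
      cases h₂ with
      | @pos _ P₂' _ h₂ =>
      refine ⟨.par (.par P₁' P₂') (ofComps S₂), .trans (.par (.par h₁ h₂) ?_) h',
        hP.tail (.inr ⟨a, P₁', P₂', ofComps S₂, TopCong.of_comps_eq ?_, .refl _⟩)⟩
      · exact Cong.of_rel_comps (by rwa [comps_ofComps])
      · simp [comps, comps_ofComps, e₁, e₂]

end MCCS

/-! ### Instances of types -/

/-- `IsTypeInst P F`: the formula `F` has the shape of the synchronous type of `P`, with arbitrary
formulas, not necessarily distinct, in place of the variables. -/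
inductive IsTypeInst {C V : Type*} : MCCS C → MLLa C V → Prop where
  | one (X : MLLa C V) : IsTypeInst .one (.parr X.dual X)
  | par {P Q : MCCS C} {A B : MLLa C V} : IsTypeInst P A → IsTypeInst Q B →
      IsTypeInst (.par P Q) (.tensor A B)
  | pos (a : C) {P : MCCS C} {A : MLLa C V} (X : MLLa C V) : IsTypeInst P A →
      IsTypeInst (.pos a P) (.modPos a (.parr X.dual (.tensor A X)))
  | neg (a : C) {P : MCCS C} {A : MLLa C V} (X : MLLa C V) : IsTypeInst P A →
      IsTypeInst (.neg a P) (.parr (.modNeg a (.tensor A X.dual)) X)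

namespace MLLa

variable {C V : Type*}

@[simp]
theorem dual_dual (A : MLLa C V) : A.dual.dual = A := by
  induction A <;> simp [dual, *]

theorem inst_congr {σ τ : V → MLLa C V} {A : MLLa C V} (h : ∀ α ∈ A.vars, σ α = τ α) :
    A.inst σ = A.inst τ := by
  induction A with
  | var α => exact h α rfl
  | nvar α => exact congrArg dual (h α rfl)
  | tensor A B hA hB =>
    simp only [inst, hA fun α hα => h α (.inl hα), hB fun α hα => h α (.inr hα)]
  | parr A B hA hB =>
    simp only [inst, hA fun α hα => h α (.inl hα), hB fun α hα => h α (.inr hα)]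
  | modPos a A hA => simp only [inst, hA h]
  | modNeg a A hA => simp only [inst, hA h]

end MLLa

section

variable {C V : Type*}

theorem SyncType.isTypeInst {P : MCCS C} {A : MLLa C V} (h : SyncType P A) : IsTypeInst P A := by
  induction h with
  | one α => exact .one (.var α)
  | par _ _ _ hA hB => exact .par hA hB
  | pos a α _ _ hA => exact .pos a (.var α) hA
  | neg a α _ _ hA => exact .neg a (.var α) hA

theorem SyncType.isTypeInst_inst {P : MCCS C} {A : MLLa C V} (h : SyncType P A)
    (σ : V → MLLa C V) : IsTypeInst P (A.inst σ) := by
  induction h with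
  | one α => exact .one (σ α)
  | par _ _ _ hA hB => exact .par hA hB
  | pos a α _ _ hA => exact .pos a (σ α) hA
  | neg a α _ _ hA => exact .neg a (σ α) hA

/-- All formulas of the shape of a type are instances of that type, because the variables of the
type are distinct. -/
theorem SyncType.exists_inst_eq {P : MCCS C} {A F : MLLa C V} (h : SyncType P A)
    (hF : IsTypeInst P F) : ∃ σ : V → MLLa C V, A.inst σ = F := by
  classical
  induction h generalizing F with
  | one α =>
    cases hF with
    | one X => exact ⟨fun _ => X, rfl⟩
  | @par P Q A B _ _ hd hA hB =>
    cases hF with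
    | par hF hG =>
      obtain ⟨σ, rfl⟩ := hA hF
      obtain ⟨τ, rfl⟩ := hB hG
      refine ⟨fun α => if α ∈ A.vars then σ α else τ α, ?_⟩
      simp only [MLLa.inst]
      congr 1
      · exact MLLa.inst_congr fun α hα => if_pos hα
      · exact MLLa.inst_congr fun α hα => if_neg fun h => Set.disjoint_left.1 hd h hα
  | @pos a P A α _ hα hA =>
    cases hF with
    | pos _ X hF =>
      obtain ⟨σ, rfl⟩ := hA hF
      refine ⟨Function.update σ α X, ?_⟩
      have : A.inst (Function.update σ α X) = A.inst σ :=
        MLLa.inst_congr fun β hβ => Function.update_of_ne (fun h : β = α => hα (h ▸ hβ)) _ _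
      simp [MLLa.inst, this]
  | @neg a P A α _ hα hA =>
    cases hF with
    | neg _ X hF =>
      obtain ⟨σ, rfl⟩ := hA hF
      refine ⟨Function.update σ α X, ?_⟩
      have : A.inst (Function.update σ α X) = A.inst σ :=
        MLLa.inst_congr fun β hβ => Function.update_of_ne (fun h : β = α => hα (h ▸ hβ)) _ _
      simp [MLLa.inst, this]

theorem MLLa.dual_ne_modNeg_tensor_dual (a : C) (A X : MLLa C V) :
    X.dual ≠ .modNeg a (.tensor A X.dual) := by
  intro h
  have := congrArg sizeOf h
  simp at this
  omega

/-- A formula has the shape of the type of at most one term. -/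
theorem IsTypeInst.unique {P Q : MCCS C} {F : MLLa C V} (hP : IsTypeInst P F)
    (hQ : IsTypeInst Q F) : P = Q := by
  induction hP generalizing Q with
  | one X =>
    generalize hF : MLLa.parr X.dual X = F at hQ
    cases hQ with
    | one => rfl
    | par => cases hF
    | pos => cases hF
    | neg a Y hA =>
      injection hF with h h'
      subst h'
      exact absurd h (MLLa.dual_ne_modNeg_tensor_dual _ _ _)
  | par _ _ ih ih' =>
    cases hQ with
    | par h h' => rw [ih h, ih' h']
  | @pos a P A X _ ih =>
    generalize hF : MLLa.modPos a (.parr X.dual (.tensor A X)) = F at hQ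
    cases hQ with
    | pos b Y hA =>
      injection hF with h h'
      injection h' with _ h'
      injection h' with h'
      rw [h, ih (h' ▸ hA)]
    | _ => cases hF
  | @neg a P A X _ ih =>
    generalize hF : MLLa.parr (.modNeg a (.tensor A X.dual)) X = F at hQ
    cases hQ with
    | one Y =>
      injection hF with h h'
      subst h'
      exact absurd h.symm (MLLa.dual_ne_modNeg_tensor_dual _ _ _)
    | neg b Y hA =>
      injection hF with h
      injection h with h h'
      injection h' with h'
      rw [h, ih (h' ▸ hA)]
    | _ => cases hF

/-! ### Derived rules of MLL -/

namespace MLLa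

/-- The sequent `A ⊢ B`, in one-sided form. -/
def Ent (A B : MLLa C V) : Prop := MLLProvable [A.dual, B]

theorem MLLProvable.swap {A B : MLLa C V} (h : MLLProvable [A, B]) : MLLProvable [B, A] :=
  h.exch (.swap _ _ _)

theorem Ent.refl (A : MLLa C V) : Ent A A := .ax A

theorem Ent.trans {A B D : MLLa C V} (h : Ent A B) (h' : Ent B D) : Ent A D :=
  MLLProvable.cut (Γ := [A.dual]) (Δ := [D]) (MLLProvable.swap h) h'

theorem Ent.limp {A B : MLLa C V} (h : Ent A B) : MLLProvable [limp A B] := .parr h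

/-- Tensor on the left of a sequent with one formula on the right. -/
theorem Ent.of_tensor {A B D : MLLa C V} (h : MLLProvable [A.dual, B.dual, D]) :
    Ent (tensor A B) D := .parr h

theorem Ent.tensor {A A' B B' : MLLa C V} (h : Ent A A') (h' : Ent B B') :
    Ent (tensor A B) (tensor A' B') :=
  .of_tensor (.exch (by simpa using List.perm_append_comm (l₁ := [_]) (l₂ := [_, _]))
    (MLLProvable.tensor (MLLProvable.swap h) (MLLProvable.swap h')))

theorem Ent.tensor_comm (A B : MLLa C V) : Ent (MLLa.tensor A B) (MLLa.tensor B A) :=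
  .of_tensor (.exch (List.reverse_perm' (l₁ := [_, _, _]) |>.2 (.refl _))
    (MLLProvable.tensor (Γ := [B.dual]) (Δ := [A.dual])
      (MLLProvable.swap (.ax B)) (MLLProvable.swap (.ax A))))

theorem MLLProvable.tensor_intro (A B : MLLa C V) :
    MLLProvable [A.dual, B.dual, MLLa.tensor A B] :=
  .exch (by simpa using List.perm_append_comm (l₁ := [_]) (l₂ := [_, _]))
    (MLLProvable.tensor (MLLProvable.swap (.ax A)) (MLLProvable.swap (.ax B)))

theorem Ent.tensor_assoc (A B D : MLLa C V) :
    Ent (MLLa.tensor (MLLa.tensor A B) D) (MLLa.tensor A (MLLa.tensor B D)) := by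
  refine .of_tensor (.parr ?_)
  have h : MLLProvable [MLLa.tensor B D, B.dual, D.dual] :=
    (MLLProvable.tensor_intro B D).exch (List.perm_append_comm (l₁ := [_, _]) (l₂ := [_]))
  exact (MLLProvable.tensor (Γ := [A.dual]) (MLLProvable.swap (.ax A)) h).exch
    (List.perm_append_comm (l₁ := [_]) (l₂ := [_, _, _]))

theorem Ent.tensor_assoc' (A B D : MLLa C V) :
    Ent (MLLa.tensor A (MLLa.tensor B D)) (MLLa.tensor (MLLa.tensor A B) D) :=
  (Ent.tensor_comm _ _).trans (((Ent.tensor_comm _ _).tensor (.refl _)).trans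
    ((Ent.tensor_assoc _ _ _).trans ((Ent.tensor_comm _ _).trans
      ((Ent.tensor_comm _ _).tensor (.refl _)))))

theorem Ent.tensor_limp (A B : MLLa C V) : Ent (MLLa.tensor A (MLLa.limp A B)) B := by
  refine .of_tensor ?_
  have := MLLProvable.tensor_intro A B.dual
  rw [dual_dual] at this
  simp only [MLLa.limp, dual, dual_dual]
  exact this.exch ((List.Perm.swap _ _ _).cons _)

theorem Ent.tensor_limp_self (A X : MLLa C V) : Ent A (MLLa.tensor A (MLLa.limp X X)) :=
  MLLProvable.swap (MLLProvable.tensor (Γ := [A.dual]) (Δ := []) (MLLProvable.swap (.ax A))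
    (.parr (.ax X)))

end MLLa

/-! ### From executions to proofs -/

/-- Each instance of the type of `Q` follows in MLL from some instance of the type of `P`. -/
def Entails (V : Type*) {C : Type*} (P Q : MCCS C) : Prop :=
  ∀ G : MLLa C V, IsTypeInst Q G → ∃ F, IsTypeInst P F ∧ MLLa.Ent F G

namespace Entails

open MLLa

theorem refl (P : MCCS C) : Entails V P P := fun G hG => ⟨G, hG, .refl G⟩

theorem trans {P Q R : MCCS C} (h : Entails V P Q) (h' : Entails V Q R) : Entails V P R := by
  intro H hH
  obtain ⟨G, hG, h₂⟩ := h' H hH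
  obtain ⟨F, hF, h₁⟩ := h G hG
  exact ⟨F, hF, h₁.trans h₂⟩

theorem of_topCong {P Q : MCCS C} (h : MCCS.TopCong P Q) : Entails V P Q ∧ Entails V Q P := by
  have comm (P Q : MCCS C) : Entails V (.par P Q) (.par Q P) := by
    rintro _ (_ | ⟨hQ, hP⟩)
    exact ⟨_, .par hP hQ, .tensor_comm _ _⟩
  induction h with
  | refl P => exact ⟨refl P, refl P⟩
  | symm _ ih => exact ih.symm
  | trans _ _ ih ih' => exact ⟨ih.1.trans ih'.1, ih'.2.trans ih.2⟩
  | par_comm P Q => exact ⟨comm P Q, comm Q P⟩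
  | par_assoc P Q R =>
    constructor
    · rintro _ (_ | ⟨hP, _ | ⟨hQ, hR⟩⟩)
      exact ⟨_, .par (.par hP hQ) hR, .tensor_assoc _ _ _⟩
    · rintro _ (_ | ⟨_ | ⟨hP, hQ⟩, hR⟩)
      exact ⟨_, .par hP (.par hQ hR), .tensor_assoc' _ _ _⟩
  | par_one P =>
    constructor
    · intro G hG
      exact ⟨_, .par hG (.one G), .tensor_limp G G⟩
    · rintro _ (_ | @⟨_, _, A, _, hP, ⟨X⟩⟩)
      exact ⟨A, hP, .tensor_limp_self A X⟩
  | par _ _ ih ih' =>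
    have par {P P' Q Q' : MCCS C} (h : Entails V P P') (h' : Entails V Q Q') :
        Entails V (.par P Q) (.par P' Q') := by
      rintro _ (_ | ⟨hP, hQ⟩)
      obtain ⟨F, hF, h₁⟩ := h _ hP
      obtain ⟨G, hG, h₂⟩ := h' _ hQ
      exact ⟨_, .par hF hG, h₁.tensor h₂⟩
    exact ⟨par ih.1 ih'.1, par ih.2 ih'.2⟩

theorem sync (a : C) (P Q R : MCCS C) :
    Entails V (.par (.par (.neg a P) (.pos a Q)) R) (.par (.par P Q) R) := by
  rintro _ (_ | @⟨_, _, _, D, _ | @⟨_, _, A, B, hP, hQ⟩, hR⟩)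
  -- with these formulas, both prefixes carry the modal formula `⟨a⟩(A ⊸ B ⊗ A)`, up to duality
  refine ⟨_, .par (.par (.neg a (.tensor B A) hP) (.pos a A hQ)) hR, Ent.tensor ?_ (.refl _)⟩
  have h := Ent.tensor_limp (.modPos a (.parr A.dual (.tensor B A))) (.tensor B A)
  simp only [limp, dual, dual_dual] at h
  exact (Ent.tensor_comm _ _).trans (h.trans (Ent.tensor_comm _ _))

theorem of_exec {P Q : MCCS C} (h : MCCS.Exec MCCS.TopCong P Q) : Entails V P Q := by
  induction h with
  | refl => exact refl P
  | tail _ hs ih =>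
    refine ih.trans ?_
    obtain h | ⟨a, P, Q, R, h, h'⟩ := hs
    · exact (of_topCong h).1
    · exact (of_topCong h).1.trans ((sync a P Q R).trans (of_topCong h').1)

end Entails

/-! ### A phase space of executions -/

namespace Phase

open MCCS MLLa
open scoped Pointwise

/-- The monoid of the phase space: pairs of a multiset of available components and a multiset of
components to reach. -/
abbrev Conf (C : Type*) := Multiset (Guard C) × Multiset (Guard C)

/-- The pole of the phase space. -/
def pole (C : Type*) : Set (Conf C) := {m | Reds m.1 m.2}

/-- The orthogonal of a set with respect to the pole. -/
def orth (X : Set (Conf C)) : Set (Conf C) := {m | ∀ x ∈ X, m + x ∈ pole C}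

theorem add_mem_pole {m n : Conf C} (hm : m ∈ pole C) (hn : n ∈ pole C) : m + n ∈ pole C :=
  Reds.add hm hn

theorem orth_anti {X Y : Set (Conf C)} (h : X ⊆ Y) : orth Y ⊆ orth X :=
  fun _ hm x hx => hm x (h hx)

theorem subset_orth_orth (X : Set (Conf C)) : X ⊆ orth (orth X) :=
  fun m hm x hx => by rw [add_comm]; exact hx m hm

theorem mem_orth_of_reds {S S' T : Multiset (Guard C)} {X : Set (Conf C)} (h : Reds S S')
    (hS : (S', T) ∈ orth X) : (S, T) ∈ orth X :=
  fun x hx => (h.add_right x.1).trans (hS x hx)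

theorem orth_orth_orth (X : Set (Conf C)) : orth (orth (orth X)) = orth X :=
  (orth_anti (subset_orth_orth X)).antisymm (subset_orth_orth _)

theorem add_subset_pole_iff {X Y : Set (Conf C)} : X + Y ⊆ pole C ↔ Y ⊆ orth X := by
  constructor
  · intro h y hy x hx
    rw [add_comm]
    exact h (Set.add_mem_add hx hy)
  · rintro h _ ⟨x, hx, y, hy, rfl⟩
    show x + y ∈ _
    rw [add_comm]
    exact h hy x hx

/-- The interpretation of `⟨a⟩(L ⅋ B)`, where `X` is the interpretation of `B`. The first condition
makes `ā.P` an element of the interpretation of `⟨a⟩(L ⅋ B) ⊸ B` for each `P` of type `L^⊥`, and the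
second one bounds the interpretation of types of terms `a.Q`. -/
def modSet (a : C) (L B : MLLa C V) (X : Set (Conf C)) : Set (Conf C) :=
  {m | (∀ P, IsTypeInst P L.dual → m + ({.neg a P}, 0) ∈ X) ∧
    ∀ Q, IsTypeInst (.pos a Q) (.modPos a (.parr L B)) → m + (0, {.pos a Q}) ∈ pole C}

theorem orth_orth_modSet (a : C) (L B : MLLa C V) {X : Set (Conf C)} (hX : orth (orth X) = X) :
    orth (orth (modSet a L B X)) = modSet a L B X := by
  refine Set.Subset.antisymm (fun m hm => ⟨fun P hP => ?_, fun Q hQ => ?_⟩) (subset_orth_orth _)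
  · rw [← hX]
    intro x hx
    rw [add_assoc]
    refine hm _ fun n hn => ?_
    rw [add_comm, ← add_assoc, add_comm]
    exact hx _ (hn.1 P hP)
  · exact hm _ fun n hn => by rw [add_comm]; exact hn.2 Q hQ

/-- The interpretation of formulas, for a valuation `θ` of the variables. The modality
`⟨ā⟩(L ⊗ B)` is interpreted as the dual of `⟨a⟩(L^⊥ ⅋ B^⊥)`; modalities
on formulas of other shapes do not occur in types, and their interpretation is immaterial. -/
def interp (θ : V → Multiset (Guard C)) : MLLa C V → Set (Conf C)
  | var α => orth {(0, θ α)}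
  | nvar α => orth (orth {(0, θ α)})
  | tensor A B => orth (orth (interp θ A + interp θ B))
  | parr A B => orth (orth (interp θ A) + orth (interp θ B))
  | modPos a (parr L B) => modSet a L B (interp θ B)
  | modNeg a (tensor L B) => orth (modSet a L.dual B.dual (orth (interp θ B)))
  | modPos _ _ => orth ∅
  | modNeg _ _ => orth (orth ∅)

theorem orth_orth_interp (θ : V → Multiset (Guard C)) (A : MLLa C V) :
    orth (orth (interp θ A)) = interp θ A := by
  induction A using interp.induct with
  | case5 a L B ih => simp only [interp, orth_orth_modSet a L B ih]
  | _ => simp only [interp, orth_orth_orth]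

theorem interp_dual (θ : V → Multiset (Guard C)) (A : MLLa C V) :
    interp θ A.dual = orth (interp θ A) := by
  induction A using interp.induct with
  | case1 => simp only [dual, interp]
  | case2 => simp only [dual, interp, orth_orth_orth]
  | case3 A B hA hB => simp only [dual, interp, hA, hB, orth_orth_interp, orth_orth_orth]
  | case4 A B hA hB => simp only [dual, interp, hA, hB]
  | case5 a L B ih => simp only [dual, interp, dual_dual, ih, orth_orth_interp]
  | case6 a L B ih =>
    simp only [dual, interp, ih]
    rw [orth_orth_modSet _ _ _ (orth_orth_orth _)]
  | case7 a A h =>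
    cases A with
    | parr A B => exact absurd rfl (h A B)
    | _ => simp only [dual, interp]
  | case8 a A h =>
    cases A with
    | tensor A B => exact absurd rfl (h A B)
    | _ => simp only [dual, interp, orth_orth_orth]

theorem sound (θ : V → Multiset (Guard C)) {Γ : List (MLLa C V)} (h : MLLProvable Γ) :
    (Γ.map fun A => orth (interp θ A)).sum ⊆ pole C := by
  induction h with
  | ax A =>
    simp only [List.map_cons, List.map_nil, List.sum_cons, List.sum_nil, add_zero, interp_dual]
    rw [add_subset_pole_iff]
    exact subset_orth_orth _
  | @cut A Γ Δ _ _ ih ih' =>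
    simp only [List.map_cons, List.sum_cons, interp_dual, add_subset_pole_iff,
      List.map_append, List.sum_append] at ih ih' ⊢
    rw [orth_orth_interp] at ih ih'
    exact ih'.trans (orth_anti ih)
  | @tensor A B Γ Δ _ _ ih ih' =>
    simp only [List.map_cons, List.sum_cons, add_subset_pole_iff,
      List.map_append, List.sum_append, interp] at ih ih' ⊢
    rw [orth_orth_interp] at ih ih'
    rw [orth_orth_orth]
    exact (Set.add_subset_add ih ih').trans (subset_orth_orth _)
  | @parr A B Γ _ ih =>
    simp only [List.map_cons, List.sum_cons, interp, ← add_assoc] at ih ⊢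
    rw [add_subset_pole_iff] at ih ⊢
    rwa [orth_orth_orth]
  | exch hp _ ih => rwa [← (hp.map _).sum_eq]

theorem interp_subset_of_provable_limp (θ : V → Multiset (Guard C)) {A B : MLLa C V}
    (h : MLLProvable [limp A B]) : interp θ A ⊆ interp θ B := by
  have h0 := sound θ h
  simp only [List.map_cons, List.map_nil, List.sum_cons, List.sum_nil, limp, interp,
    add_subset_pole_iff] at h0
  rw [orth_orth_orth, interp_dual, orth_orth_interp] at h0
  intro m hm
  rw [← orth_orth_interp θ B]
  intro x hx
  simpa using h0 (Set.mem_zero.2 rfl) _ (Set.add_mem_add hm hx)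

/-! ### Interpretation of types -/

/-- A term belongs to the interpretation of every instance of its type. The induction is on the
formula: for `a.P`, it is applied to the terms that may synchronise with `a.P`, whose types are
subformulas of that of `a.P`. -/
theorem _root_.IsTypeInst.mem_interp {P : MCCS C} {F : MLLa C V} (h : IsTypeInst P F)
    (θ : V → Multiset (Guard C)) : (P.comps, 0) ∈ interp θ F := by
  have htensor {P Q : MCCS C} {A B : MLLa C V} (hP : (P.comps, 0) ∈ interp θ A)
      (hQ : (Q.comps, 0) ∈ interp θ B) : (P.comps + Q.comps, 0) ∈ interp θ (.tensor A B) := by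
    rw [interp]
    have := Set.add_mem_add hP hQ
    rw [Prod.mk_add_mk, add_zero] at this
    exact subset_orth_orth _ this
  cases h with
  | one X =>
    rw [interp, interp_dual, orth_orth_interp]
    rintro _ ⟨x, hx, y, hy, rfl⟩
    change 0 + (x + y) ∈ _
    rw [zero_add, add_comm]
    exact hy x hx
  | par hA hB => exact htensor (hA.mem_interp θ) (hB.mem_interp θ)
  | @pos a P A X hA =>
    rw [interp]
    refine ⟨fun Q hQ => ?_, fun Q hQ => ?_⟩
    · rw [dual_dual] at hQ
      have hmem := htensor (hA.mem_interp θ) (hQ.mem_interp θ)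
      rw [← orth_orth_interp] at hmem ⊢
      refine mem_orth_of_reds (.single ?_) hmem
      simpa [comps, add_comm] using Red.comm a Q P 0
    · cases hQ.unique (.pos a X hA)
      simpa [pole, comps] using Reds.refl _
  | @neg a P A X hA =>
    rw [interp, ← interp_dual]
    rintro _ ⟨n, hn, y, hy, rfl⟩
    simp only [dual, dual_dual, interp] at hn
    have := hn.1 P (by rwa [dual_dual])
    change _ + (n + y) ∈ _
    rw [← add_assoc, add_comm _ n, add_comm]
    exact hy _ this
termination_by sizeOf F
decreasing_by all_goals (subst_vars; simp; try omega)

/-- For a suitable valuation, the interpretation of the type of `Q` contains only configurations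
that reduce to `Q`. -/
theorem _root_.SyncType.exists_valuation {Q : MCCS C} {B : MLLa C V} (h : SyncType Q B) :
    ∃ θ : V → Multiset (Guard C), ∀ θ' : V → Multiset (Guard C), (∀ α ∈ B.vars, θ' α = θ α) →
      interp θ' B ⊆ orth {(0, Q.comps)} := by
  classical
  induction h with
  | one α =>
    refine ⟨fun _ => 0, fun θ' hθ => ?_⟩
    have hα : θ' α = 0 := hθ α (.inl rfl)
    have h0 : (0 : Conf C) ∈ orth (orth {(0, 0)}) := subset_orth_orth _ rfl
    have h0' : (0 : Conf C) ∈ orth (orth (orth {(0, 0)})) := by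
      rw [orth_orth_orth]
      rintro _ rfl
      exact Reds.refl _
    intro m hm
    rw [interp, interp, interp, hα] at hm
    rintro _ rfl
    change m + (0 + 0) ∈ _
    exact hm _ (Set.add_mem_add h0' h0)
  | @par P Q A B _ _ hd hA hB =>
    obtain ⟨θ₁, h₁⟩ := hA
    obtain ⟨θ₂, h₂⟩ := hB
    refine ⟨fun α => if α ∈ A.vars then θ₁ α else θ₂ α, fun θ' hθ => ?_⟩
    have h₁ := h₁ θ' fun α hα => (hθ α (.inl hα)).trans (if_pos hα)
    have h₂ := h₂ θ' fun α hα =>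
      (hθ α (.inr hα)).trans (if_neg fun h => Set.disjoint_left.1 hd h hα)
    intro m hm
    rw [interp] at hm
    rintro _ rfl
    refine hm _ ?_
    rintro _ ⟨x, hx, y, hy, rfl⟩
    have := add_mem_pole (h₁ hx _ rfl) (h₂ hy _ rfl)
    rw [add_add_add_comm] at this
    rwa [add_comm]
  | @pos a P A α hA _ _ =>
    refine ⟨fun _ => 0, fun θ' _ m hm => ?_⟩
    rw [interp] at hm
    rintro _ rfl
    exact hm.2 P (.pos a (.var α) hA.isTypeInst)
  | @neg a P A α hA _ _ =>
    refine ⟨fun _ => {.neg a P}, fun θ' hθ m hm => ?_⟩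
    have hα : interp θ' (.var α) = orth {(0, {.neg a P})} := by rw [interp, hθ α (.inr rfl)]
    -- `0` belongs to the interpretation of `⟨a⟩(A^⊥ ⅋ α)`, so `⟨a⟩(A^⊥ ⅋ α) ⊸ α` is bounded by `α`
    have h0 : (0 : Conf C) ∈ orth (interp θ' (.modNeg a (.tensor A (.nvar α)))) := by
      rw [← interp_dual]
      simp only [dual]
      rw [interp]
      refine ⟨fun P' hP' => ?_, fun P' hP' => ?_⟩
      · rw [dual_dual] at hP'
        cases hP'.unique hA.isTypeInst
        rw [hα]
        rintro _ rfl
        simpa [pole] using Reds.refl _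
      · generalize hX : MLLa.modPos a (.parr A.dual (.var α)) = X at hP'
        cases hP' with
        | pos =>
          injection hX with _ h
          injection h with _ h
          cases h
    rw [interp] at hm
    change m ∈ orth {(0, {.neg a P})}
    rw [← hα, ← orth_orth_interp]
    intro x hx
    simpa using hm _ (Set.add_mem_add h0 hx)

theorem exec_of_provable {P Q : MCCS C} {F B : MLLa C V} (hF : IsTypeInst P F)
    (hB : SyncType Q B) (h : MLLProvable [limp F B]) : Exec TopCong P Q := by
  obtain ⟨θ, hθ⟩ := hB.exists_valuation
  have := hθ θ (fun _ _ => rfl) (interp_subset_of_provable_limp θ h (hF.mem_interp θ)) _ rfl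
  exact Reds.exec (by simpa [pole] using this)

end Phase

/-- An execution amounts to a proof between instances of types. -/
theorem exec_topCong_iff {P Q : MCCS C} {A B : MLLa C V} (hA : SyncType P A)
    (hB : SyncType Q B) :
    MCCS.Exec MCCS.TopCong P Q ↔ ∃ σ : V → MLLa C V, MLLa.MLLProvable [MLLa.limp (A.inst σ) B] := by
  constructor
  · intro h
    obtain ⟨F, hF, hFB⟩ := Entails.of_exec (V := V) h B hB.isTypeInst
    obtain ⟨σ, rfl⟩ := hA.exists_inst_eq hF
    exact ⟨σ, hFB.limp⟩
  · rintro ⟨σ, h⟩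
    exact Phase.exec_of_provable (hA.isTypeInst_inst σ) hB h

end

theorem mainTheorem1 {C V : Type*} [Infinite V] (P Q : MCCS C) (A B : MLLa C V)
    (hA : SyncType P A) (hB : SyncType Q B) :
    (MCCS.Exec MCCS.TopCong P Q ↔
      ∃ σ : V → MLLa C V, MLLa.MLLProvable [MLLa.limp (A.inst σ) B]) ∧
    (MCCS.Exec MCCS.Cong P Q ↔
      ∃ (Q' : MCCS C) (B' : MLLa C V), MCCS.Cong Q' Q ∧ SyncType Q' B' ∧
        ∃ σ : V → MLLa C V, MLLa.MLLProvable [MLLa.limp (A.inst σ) B']) := by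
  refine ⟨exec_topCong_iff hA hB, fun h => ?_, ?_⟩
  · obtain ⟨Q', hQ, h⟩ := h.exists_topCong_exec
    obtain ⟨B', hB'⟩ := exists_syncType (V := V) Q'
    exact ⟨Q', B', hQ, hB', (exec_topCong_iff hA hB').1 h⟩
  · rintro ⟨Q', B', hQ, hB', h⟩
    exact ((exec_topCong_iff hA hB').2 h).of_topCong.tail (.inl hQ)
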